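/- Let $n\ge 3$ and consider $2n$ points on the unit circle labelled clockwise $1,2,\dots,2n$. The odd points (hollow vertices) span the hollow polygon and the even points (solid vertices) span the solid polygon. A diagonal of one of these polygons is a segment joining two of its vertices; it is either a boundary edge or internal. A dissection of a polygon is a set of pairwise non-crossing internal diagonals; a hollow (resp. solid) dissection is a dissection of the hollow (resp. solid) polygon. For a hollow dissection $D_\circ$, let $\overline{D}_\circ$ be $D_\circ$ together with all boundary edges of the hollow polygon; the cells of $D_\circ$ are the closures of the connected components of the hollow polygon minus the diagonals of $D_\circ$. A solid diagonal $\delta_\bullet$ is a $D_\circ$-accordion diagonal if the set of elements of $\overline{D}_\circ$ that it crosses is connected. A $D_\circ$-accordion dissection is a (not necessarily maximal) set of pairwise non-crossing internal $D_\circ$-accordion diagonals. For $\delta_\circ\in D_\circ$ and a $D_\circ$-accordion diagonal $\delta_\bullet$, define $\varepsilon(\delta_\circ\in D_\circ\mid\delta_\bullet)\in\{-1,0,1\}$ as follows. It is $0$ if $\delta_\circ$ and $\delta_\bullet$ do not cross. If they cross, let $\mu_\circ,\nu_\circ$ be the other elements of $\overline{D}_\circ$ crossed by $\delta_\bullet$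 in the two cells of $D_\circ$ containing $\delta_\circ$. If $\mu_\circ=ab$, $\delta_\circ=bc$, $\nu_\circ=cd$ form a path $a-b-c-d$, the value is $1$ if $a,b,d,c$ are in clockwise order (the path is a $\mathsf{Z}$) and $-1$ if $b,a,c,d$ are in clockwise order (the path is an $\mathsf{S}$); otherwise ($\mu_\circ,\delta_\circ,\nu_\circ$ share a vertex) the value is $0$. The $g$-vector of $\delta_\bullet$ with respect to $D_\circ$ is $$g(D_\circ\mid\delta_\bullet)=\sum_{\delta_\circ\in D_\circ}\varepsilon(\delta_\circ\in D_\circ\mid\delta_\bullet)\,e_{\delta_\circ}\in\mathbb R^{D_\circ},$$ where $(e_{\delta_\circ})_{\delta_\circ\in D_\circ}$ is the canonical basis of $\mathbb R^{D_\circ}$. The $g$-vector fan of $D_\circ$ is the collection of cones $$\mathcal F^g(D_\circ)=\bigl\{\mathbb R_{\ge0}\{g(D_\circ\mid\delta_\bullet):\delta_\bullet\in D_\bullet\}\;:\;D_\bullet\text{ a }D_\circ\text{-accordion dissection}\bigr\},$$ where $\mathbb R_{\ge0}X$ denotes the cone of nonnegative linear combinations of $X$. **Theorem.** Let $D_\circ\subseteq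 D'_\circ$ be two hollow dissections, and identify $\mathbb R^{D_\circ}$ with the subspace of $\mathbb R^{D'_\circ}$ spanned by $\{e_{\delta_\circ}:\delta_\circ\in D_\circ\}$. Then $$\mathcal F^g(D_\circ)=\{C\in\mathcal F^g(D'_\circ):C\subseteq\mathbb R^{D_\circ}\}=\{C\cap\mathbb R^{D_\circ}:C\in\mathcal F^g(D'_\circ)\}.$$ That is, the $g$-vector fan of $D_\circ$ is precisely the set of cones of the $g$-vector fan of $D'_\circ$ that lie in $\mathbb R^{D_\circ}$, and it coincides with the section of the $g$-vector fan of $D'_\circ$ by $\mathbb R^{D_\circ}$. -/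

import Mathlib

noncomputable section

namespace Accordion

/-! ### Points on the circle, diagonals, crossings -/

/-- The points of the circle are labelled clockwise by `1, 2, …, 2n`.  `Clockwise a b c` says that
going clockwise from the point `a` one meets first `b` and then `c`, the three points being
distinct. -/
def Clockwise (a b c : ℕ) : Prop :=
  (a < b ∧ b < c) ∨ (b < c ∧ c < a) ∨ (c < a ∧ a < b)

/-- The hollow vertices `1, 3, …, 2n - 1`. -/
def hollow (n : ℕ) : Set ℕ := {a | Odd a ∧ 1 ≤ a ∧ a ≤ 2 * n}

/-- The solid vertices `2, 4, …, 2n`. -/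
def solid (n : ℕ) : Set ℕ := {a | Even a ∧ 1 ≤ a ∧ a ≤ 2 * n}

/-- A diagonal (internal or boundary) of the polygon with vertex set `V`, as an unordered pair of
distinct vertices. -/
def IsDiagonal (V : Set ℕ) (e : Sym2 ℕ) : Prop :=
  ∃ a ∈ V, ∃ b ∈ V, a ≠ b ∧ e = s(a, b)

/-- A boundary edge of the polygon with vertex set `V`: it joins a vertex `a` to the vertex `b`
that follows it clockwise. -/
def IsBoundaryEdge (V : Set ℕ) (e : Sym2 ℕ) : Prop :=
  ∃ a ∈ V, ∃ b ∈ V, a ≠ b ∧ (∀ c ∈ V, ¬ Clockwise a c b) ∧ e = s(a, b)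

/-- An internal diagonal of the polygon with vertex set `V`. -/
def IsInternalDiagonal (V : Set ℕ) (e : Sym2 ℕ) : Prop :=
  IsDiagonal V e ∧ ¬ IsBoundaryEdge V e

/-- Two chords of the circle cross (in their relative interiors) when their endpoints are four
distinct points that interleave on the circle. -/
def Crosses (e f : Sym2 ℕ) : Prop :=
  ∃ a b c d, e = s(a, b) ∧ f = s(c, d) ∧ Clockwise a c b ∧ Clockwise b d a

/-! ### Dissections and cells -/

/-- A dissection of the polygon with vertex set `V`: a set of pairwise non-crossing internal
diagonals. -/
def IsDissection (V : Set ℕ) (D : Finset (Sym2 ℕ)) : Prop :=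
  (∀ e ∈ D, IsInternalDiagonal V e) ∧ ∀ e ∈ D, ∀ f ∈ D, ¬ Crosses e f

/-- The diagonals of `D` together with all boundary edges of the polygon. -/
def withBoundary (V : Set ℕ) (D : Finset (Sym2 ℕ)) : Set (Sym2 ℕ) :=
  {e | e ∈ D ∨ IsBoundaryEdge V e}

/-- A cell of the dissection `D`, given by its set of vertices: a maximal set of vertices no two of
which are separated by a diagonal of `D`.  The cell itself is the convex hull of these vertices, and
its edges are the elements of `withBoundary V D` with both endpoints in `C`. -/
def IsCell (V : Set ℕ) (D : Finset (Sym2 ℕ)) (C : Set ℕ) : Prop :=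
  Maximal (fun C : Set ℕ => C ⊆ V ∧ ∀ a ∈ C, ∀ b ∈ C, ∀ e ∈ D, ¬ Crosses e s(a, b)) C

/-- The diagonal `e` is contained in the cell with vertex set `C`. -/
def InCell (e : Sym2 ℕ) (C : Set ℕ) : Prop := ∀ a ∈ e, a ∈ C

/-! ### Accordions -/

/-- The hollow diagonals of `D` and boundary edges of the hollow polygon crossed by `δ`.  A solid
diagonal crosses exactly two boundary edges of the hollow polygon, so for solid `δ` this is the cut
of `D` by the line carrying `δ`. -/
def crossedBy (n : ℕ) (D : Finset (Sym2 ℕ)) (δ : Sym2 ℕ) : Set (Sym2 ℕ) :=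
  {e | e ∈ withBoundary (hollow n) D ∧ Crosses e δ}

/-- A set of diagonals is connected (as a graph whose edges are these diagonals): it is nonempty,
and any two of them are linked by a chain of diagonals of the set in which consecutive ones share
an endpoint. -/
def IsConnectedChords (S : Set (Sym2 ℕ)) : Prop :=
  S.Nonempty ∧ ∀ e ∈ S, ∀ f ∈ S,
    Relation.ReflTransGen (fun x y => x ∈ S ∧ y ∈ S ∧ ∃ v, v ∈ x ∧ v ∈ y) e f

/-- `δ` is a `D`-accordion diagonal: a solid diagonal whose cut of `D` is connected, i.e. an
accordion. -/
def IsAccordionDiagonal (n : ℕ) (D : Finset (Sym2 ℕ)) (δ : Sym2 ℕ) : Prop :=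
  IsDiagonal (solid n) δ ∧ IsConnectedChords (crossedBy n D δ)

/-- A `D`-accordion dissection: a set of pairwise non-crossing internal `D`-accordion diagonals. -/
def IsAccordionDissection (n : ℕ) (D A : Finset (Sym2 ℕ)) : Prop :=
  IsDissection (solid n) A ∧ ∀ δ ∈ A, IsAccordionDiagonal n D δ

/-! ### `g`-vectors -/

/-- `μ δ ν` is a path `a — b — c — d` with `δ = bc`, shaped as the letter `Z`: its vertices are met
clockwise in the order `a` (top left), `b` (top right), `d` (bottom right), `c` (bottom left). -/
def IsZ (μ δ ν : Sym2 ℕ) : Prop :=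
  ∃ a b c d, μ = s(a, b) ∧ δ = s(b, c) ∧ ν = s(c, d) ∧ Clockwise a b d ∧ Clockwise a d c

/-- `μ δ ν` is a path `a — b — c — d` with `δ = bc`, shaped as the letter `S`: its vertices are met
clockwise in the order `b` (top left), `a` (top right), `c` (bottom right), `d` (bottom left). -/
def IsS (μ δ ν : Sym2 ℕ) : Prop :=
  ∃ a b c d, μ = s(a, b) ∧ δ = s(b, c) ∧ ν = s(c, d) ∧ Clockwise b a c ∧ Clockwise b c d

/-- `μ` and `ν` are the other diagonals of `D` with boundary that are crossed by the solid diagonal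
`δ` in the two cells of `D` containing the diagonal `d`. -/
def AreNeighbors (n : ℕ) (D : Finset (Sym2 ℕ)) (d δ μ ν : Sym2 ℕ) : Prop :=
  ∃ C₁ C₂ : Set ℕ, IsCell (hollow n) D C₁ ∧ IsCell (hollow n) D C₂ ∧ C₁ ≠ C₂ ∧
    InCell d C₁ ∧ InCell d C₂ ∧
    (μ ∈ crossedBy n D δ ∧ μ ≠ d ∧ InCell μ C₁) ∧
    (ν ∈ crossedBy n D δ ∧ ν ≠ d ∧ InCell ν C₂)

open Classical in
/-- The sign of the solid diagonal `δ` at the hollow diagonal `d` of `D`: it is `1` or `-1` if `δ`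
crosses `d` and slaloms on it as a `Z` or an `S`, and `0` otherwise. -/
def slalomSign (n : ℕ) (D : Finset (Sym2 ℕ)) (d δ : Sym2 ℕ) : ℝ :=
  if Crosses d δ ∧ ∃ μ ν, AreNeighbors n D d δ μ ν ∧ IsZ μ d ν then 1
  else if Crosses d δ ∧ ∃ μ ν, AreNeighbors n D d δ μ ν ∧ IsS μ d ν then -1
  else 0

/-- The `g`-vector of `δ` with respect to `D`, in `ℝ^D`. -/
def gVector (n : ℕ) (D : Finset (Sym2 ℕ)) (δ : Sym2 ℕ) : D → ℝ :=
  fun d => slalomSign n D d δ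

/-- The `g`-vector fan of `D`: the cones in `ℝ^D` spanned by the `g`-vectors of the diagonals of
each (not necessarily maximal) `D`-accordion dissection. -/
def gVectorFan (n : ℕ) (D : Finset (Sym2 ℕ)) : Set (PointedCone ℝ (D → ℝ)) :=
  {K | ∃ A : Finset (Sym2 ℕ), IsAccordionDissection n D A ∧
    K = PointedCone.hull ℝ (gVector n D '' (A : Set (Sym2 ℕ)))}

/-! ### Coordinate subspaces and sections -/

/-- The coordinate subspace of `ℝ^D'` spanned by the basis vectors `e_d` with `d ∈ D`. -/
def coordSubspace (D D' : Finset (Sym2 ℕ)) : Submodule ℝ (D' → ℝ) :=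
  Submodule.span ℝ {x | ∃ d : D', (d : Sym2 ℕ) ∈ D ∧ x = Pi.single d 1}

/-- For `D ⊆ D'`, the linear map `ℝ^D → ℝ^D'` with `e_d ↦ e_d`, which identifies `ℝ^D` with
`coordSubspace D D'`. -/
def coordEmbedding {D D' : Finset (Sym2 ℕ)} (h : D ⊆ D') : (D → ℝ) →ₗ[ℝ] (D' → ℝ) :=
  Function.ExtendByZero.linearMap ℝ (fun d : D => (⟨d.1, h d.2⟩ : D'))

/-- A collection of cones in `ℝ^D`, seen as a collection of cones in `ℝ^D'`. -/
def embedFan {D D' : Finset (Sym2 ℕ)} (h : D ⊆ D') (F : Set (PointedCone ℝ (D → ℝ))) :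
    Set (PointedCone ℝ (D' → ℝ)) :=
  PointedCone.map (coordEmbedding h) '' F

/-- The section `{C ∩ V | C ∈ F}` of a fan `F` by a linear subspace `V`. -/
def fanSection {E : Type*} [AddCommGroup E] [Module ℝ E] (F : Set (PointedCone ℝ E))
    (V : Submodule ℝ E) : Set (PointedCone ℝ E) :=
  {K | ∃ C ∈ F, K = C ⊓ PointedCone.ofSubmodule V}

end Accordion

end

namespace Accordion

/-! ### Chains in the product order on `ℤ × ℤ` -/

/-! Fix a solid diagonal with endpoints p < q. A hollow chord crossing it has one endpoint on each
side. Recording the first position clockwise and the second anticlockwise from p to q turns the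
chord into a lattice point. Non-crossing chords become comparable points, so the cut of a dissection
is a finite chain. A common vertex becomes a common coordinate, connectedness becomes `Linked`, and
the Z and S slaloms become the two kinds of turn of the chain.

If D ⊆ D', the cut of D is a subchain of the cut of D' with the same two ends. Adding points to a
linked chain keeps it linked and changes no turn, and the new points are not turns. Conversely,
removing points that are not turns keeps it linked. Hence the D-accordion diagonals are exactly the
D'-accordion diagonals whose g-vector vanishes outside D (`isAccordionDiagonal_iff_of_subset`), and
for these the two g-vectors agree (`slalomSign_eq_of_subset`).

The section needs sign coherence (`slalomSign_coherent`): a Z and an S on the same hollow diagonal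
force the two solid diagonals to cross. So within one accordion dissection no cancellation occurs in
any coordinate. A nonnegative combination lying in ℝ^D therefore uses only g-vectors lying in ℝ^D,
and each section is the cone of a sub-dissection (`hull_inf_coordSubspace`). -/

/-- Two points of the plane that share a coordinate. -/
def Share (x y : ℤ × ℤ) : Prop := x.1 = y.1 ∨ x.2 = y.2

/-- Every non-maximal point of `T` shares a coordinate with a larger point, and every non-minimal
one with a smaller point. -/
def Linked (T : Set (ℤ × ℤ)) : Prop :=
  (∀ z ∈ T, ∀ w ∈ T, z < w → ∃ y ∈ T, z < y ∧ Share z y) ∧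
    ∀ z ∈ T, ∀ w ∈ T, w < z → ∃ y ∈ T, y < z ∧ Share z y

/-- The chain `T` arrives at `z` along the second coordinate and leaves along the first. -/
def ZTurn (T : Set (ℤ × ℤ)) (z : ℤ × ℤ) : Prop :=
  (∃ x ∈ T, x < z ∧ x.1 = z.1) ∧ ∃ y ∈ T, z < y ∧ y.2 = z.2

/-- The chain `T` arrives at `z` along the first coordinate and leaves along the second. -/
def STurn (T : Set (ℤ × ℤ)) (z : ℤ × ℤ) : Prop :=
  (∃ x ∈ T, x < z ∧ x.2 = z.2) ∧ ∃ y ∈ T, z < y ∧ y.1 = z.1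

variable {T T₀ : Set (ℤ × ℤ)}

theorem lt_iff_coord {x y : ℤ × ℤ} : x < y ↔ x.1 ≤ y.1 ∧ x.2 ≤ y.2 ∧ x.1 + x.2 < y.1 + y.2 := by
  rw [Prod.lt_iff]; omega

theorem chain_trichotomy (hT : IsChain (· ≤ ·) T) {x y : ℤ × ℤ} (hx : x ∈ T) (hy : y ∈ T) :
    x < y ∨ x = y ∨ y < x := by
  rcases hT.total hx hy with h | h
  · rcases h.lt_or_eq with h | h <;> simp [h]
  · rcases h.lt_or_eq with h | h <;> simp [h]

/-- A point strictly above z on its vertical line and one strictly to its right on its horizontal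
line are incomparable. So a chain leaves z along at most one coordinate. -/
theorem not_both_above (hT : IsChain (· ≤ ·) T) {z x y : ℤ × ℤ} (hx : x ∈ T) (hy : y ∈ T)
    (hzx : z < x) (hzy : z < y) (h₁ : x.1 = z.1) (h₂ : y.2 = z.2) : False := by
  rw [lt_iff_coord] at hzx hzy
  rcases hT.total hx hy with h | h <;> rw [Prod.le_def] at h <;> omega

theorem not_both_below (hT : IsChain (· ≤ ·) T) {z x y : ℤ × ℤ} (hx : x ∈ T) (hy : y ∈ T)
    (hzx : x < z) (hzy : y < z) (h₁ : x.1 = z.1) (h₂ : y.2 = z.2) : False := by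
  rw [lt_iff_coord] at hzx hzy
  rcases hT.total hx hy with h | h <;> rw [Prod.le_def] at h <;> omega

theorem exists_pred (hf : T.Finite) (hT : IsChain (· ≤ ·) T) {z w : ℤ × ℤ} (hw : w ∈ T)
    (h : w < z) : ∃ x ∈ T, x < z ∧ ∀ y ∈ T, y < z → y ≤ x := by
  obtain ⟨x, hx⟩ := (hf.subset (Set.sep_subset T (· < z))).exists_maximal ⟨w, hw, h⟩
  refine ⟨x, hx.1.1, hx.1.2, fun y hy hyz => ?_⟩
  rcases hT.total hy hx.1.1 with h | h
  exacts [h, hx.2 ⟨hy, hyz⟩ h]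

theorem exists_succ (hf : T.Finite) (hT : IsChain (· ≤ ·) T) {z w : ℤ × ℤ} (hw : w ∈ T)
    (h : z < w) : ∃ x ∈ T, z < x ∧ ∀ y ∈ T, z < y → x ≤ y := by
  obtain ⟨x, hx⟩ := (hf.subset (Set.sep_subset T (z < ·))).exists_minimal ⟨w, hw, h⟩
  refine ⟨x, hx.1.1, hx.1.2, fun y hy hyz => ?_⟩
  rcases hT.total hx.1.1 hy with h | h
  exacts [h, hx.2 ⟨hy, hyz⟩ h]

/-! ### Refining a linked chain between fixed ends -/

section Refine

variable {bot top : ℤ × ℤ}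

/-- A point inserted into a linked chain lies strictly between two points of the chain that share
a coordinate with each other and hence with it. -/
theorem exists_between (hf : T.Finite) (hT : IsChain (· ≤ ·) T) (hsub : T₀ ⊆ T)
    (hbot : bot ∈ T₀) (htop : top ∈ T₀) (hle : ∀ x ∈ T, bot ≤ x ∧ x ≤ top) (h₀ : Linked T₀)
    {z : ℤ × ℤ} (hz : z ∈ T) (hz₀ : z ∉ T₀) :
    ∃ x ∈ T₀, ∃ y ∈ T₀, x < z ∧ z < y ∧
      ((x.1 = z.1 ∧ y.1 = z.1) ∨ (x.2 = z.2 ∧ y.2 = z.2)) := by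
  have hbz : bot < z := (hle z hz).1.lt_of_ne (by rintro rfl; exact hz₀ hbot)
  have hzt : z < top := (hle z hz).2.lt_of_ne (by rintro rfl; exact hz₀ htop)
  -- x is the last point of T₀ before z. Its linked successor y cannot precede z, so z is squeezed
  -- between x and y and inherits their common coordinate.
  obtain ⟨x, hx, hxz, hmax⟩ := exists_pred (hf.subset hsub) (hT.mono hsub) hbot hbz
  obtain ⟨y, hy, hxy, hs⟩ := h₀.1 x hx top htop (hxz.trans hzt)
  have hzy : z < y := by
    rcases chain_trichotomy hT hz (hsub hy) with h | h | h
    · exact h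
    · exact absurd (h ▸ hy) hz₀
    · exact absurd (hmax y hy h) (not_le_of_gt hxy)
  refine ⟨x, hx, y, hy, hxz, hzy, ?_⟩
  rw [lt_iff_coord] at hxz hzy
  unfold Share at hs
  omega

/-- An old point keeps its partners, because the common ends bot and top make it non-extremal in T₀
whenever it is so in T. A new point takes its partners from `exists_between`. -/
theorem Linked.mono (hf : T.Finite) (hT : IsChain (· ≤ ·) T) (hsub : T₀ ⊆ T)
    (hbot : bot ∈ T₀) (htop : top ∈ T₀) (hle : ∀ x ∈ T, bot ≤ x ∧ x ≤ top) (h₀ : Linked T₀) :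
    Linked T := by
  refine ⟨fun z hz w hw hzw => ?_, fun z hz w hw hzw => ?_⟩
  · by_cases hz₀ : z ∈ T₀
    · obtain ⟨y, hy, h⟩ := h₀.1 z hz₀ top htop (hzw.trans_le (hle w hw).2)
      exact ⟨y, hsub hy, h⟩
    · obtain ⟨x, hx, y, hy, hxz, hzy, h⟩ := exists_between hf hT hsub hbot htop hle h₀ hz hz₀
      exact ⟨y, hsub hy, hzy, by unfold Share; omega⟩
  · by_cases hz₀ : z ∈ T₀
    · obtain ⟨y, hy, h⟩ := h₀.2 z hz₀ bot hbot ((hle w hw).1.trans_lt hzw)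
      exact ⟨y, hsub hy, h⟩
    · obtain ⟨x, hx, y, hy, hxz, hzy, h⟩ := exists_between hf hT hsub hbot htop hle h₀ hz hz₀
      exact ⟨x, hsub hx, hxz, by unfold Share; omega⟩

/-- The chain passes straight through an inserted point: it has partners on both sides along one
coordinate, which excludes partners along the other. -/
theorem not_turn_of_notMem (hf : T.Finite) (hT : IsChain (· ≤ ·) T) (hsub : T₀ ⊆ T)
    (hbot : bot ∈ T₀) (htop : top ∈ T₀) (hle : ∀ x ∈ T, bot ≤ x ∧ x ≤ top) (h₀ : Linked T₀)
    {z : ℤ × ℤ} (hz : z ∈ T) (hz₀ : z ∉ T₀) : ¬ ZTurn T z ∧ ¬ STurn T z := by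
  obtain ⟨x, hx, y, hy, hxz, hzy, h | h⟩ := exists_between hf hT hsub hbot htop hle h₀ hz hz₀
  · exact ⟨fun ⟨_, b, hb, hzb, e⟩ => not_both_above hT (hsub hy) hb hzy hzb h.2 e,
      fun ⟨⟨b, hb, hzb, e⟩, _⟩ => not_both_below hT (hsub hx) hb hxz hzb h.1 e⟩
  · exact ⟨fun ⟨⟨b, hb, hzb, e⟩, _⟩ => not_both_below hT hb (hsub hx) hzb hxz e h.1,
      fun ⟨_, b, hb, hzb, e⟩ => not_both_above hT hb (hsub hy) hzb hzy e h.2⟩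

/-- Linkedness gives z a partner in T₀ on every side where it has one in T, and on a given side the
chain allows only one shared coordinate. -/
theorem turn_iff_of_linked (hT : IsChain (· ≤ ·) T) (hsub : T₀ ⊆ T)
    (hbot : bot ∈ T₀) (htop : top ∈ T₀) (hle : ∀ x ∈ T, bot ≤ x ∧ x ≤ top) (h₀ : Linked T₀)
    {z : ℤ × ℤ} (hz : z ∈ T₀) : (ZTurn T₀ z ↔ ZTurn T z) ∧ (STurn T₀ z ↔ STurn T z) := by
  have up : ∀ y ∈ T, z < y → ∃ y ∈ T₀, z < y ∧ Share z y := fun y hy hzy =>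
    h₀.1 z hz top htop (hzy.trans_le (hle y hy).2)
  have down : ∀ y ∈ T, y < z → ∃ y ∈ T₀, y < z ∧ Share z y := fun y hy hzy =>
    h₀.2 z hz bot hbot ((hle y hy).1.trans_lt hzy)
  constructor
  · refine ⟨fun ⟨⟨x, hx, h⟩, y, hy, h'⟩ => ⟨⟨x, hsub hx, h⟩, y, hsub hy, h'⟩, ?_⟩
    rintro ⟨⟨x, hx, hxz, ex⟩, y, hy, hzy, ey⟩
    obtain ⟨x', hx', hxz', ex'⟩ := down x hx hxz
    obtain ⟨y', hy', hzy', ey'⟩ := up y hy hzy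
    exact ⟨⟨x', hx', hxz', ex'.elim Eq.symm fun e =>
        (not_both_below hT hx (hsub hx') hxz hxz' ex e.symm).elim⟩,
      y', hy', hzy', ey'.elim (fun e =>
        (not_both_above hT (hsub hy') hy hzy' hzy e.symm ey).elim) Eq.symm⟩
  · refine ⟨fun ⟨⟨x, hx, h⟩, y, hy, h'⟩ => ⟨⟨x, hsub hx, h⟩, y, hsub hy, h'⟩, ?_⟩
    rintro ⟨⟨x, hx, hxz, ex⟩, y, hy, hzy, ey⟩
    obtain ⟨x', hx', hxz', ex'⟩ := down x hx hxz
    obtain ⟨y', hy', hzy', ey'⟩ := up y hy hzy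
    exact ⟨⟨x', hx', hxz', ex'.elim (fun e =>
        (not_both_below hT (hsub hx') hx hxz' hxz e.symm ex).elim) Eq.symm⟩,
      y', hy', hzy', ey'.elim Eq.symm fun e =>
        (not_both_above hT hy (hsub hy') hzy hzy' ey e.symm).elim⟩

theorem exists_maximal_of_mem (hf : T.Finite) {P : ℤ × ℤ → Prop} {y : ℤ × ℤ} (hy : y ∈ T)
    (h : P y) : ∃ x ∈ T, P x ∧ y ≤ x ∧ ∀ w ∈ T, P w → ¬ x < w := by
  obtain ⟨x, hyx, hx⟩ := (hf.subset (Set.sep_subset T P)).exists_le_maximal ⟨hy, h⟩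
  exact ⟨x, hx.1.1, hx.1.2, hyx, fun w hw hP => hx.not_gt ⟨hw, hP⟩⟩

theorem exists_minimal_of_mem (hf : T.Finite) {P : ℤ × ℤ → Prop} {y : ℤ × ℤ} (hy : y ∈ T)
    (h : P y) : ∃ x ∈ T, P x ∧ x ≤ y ∧ ∀ w ∈ T, P w → ¬ w < x := by
  obtain ⟨x, hyx, hx⟩ := (hf.subset (Set.sep_subset T P)).exists_le_minimal ⟨hy, h⟩
  exact ⟨x, hx.1.1, hx.1.2, hyx, fun w hw hP => hx.not_lt ⟨hw, hP⟩⟩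

/-- From z, follow the line of a partner to the last point of T on it. If that point were outside T₀
it would not be an end, so the chain would continue from it along the other coordinate and turn
there. -/
theorem Linked.of_not_turn (hf : T.Finite) (hsub : T₀ ⊆ T)
    (hbot : bot ∈ T₀) (htop : top ∈ T₀) (hle : ∀ x ∈ T, bot ≤ x ∧ x ≤ top) (h : Linked T)
    (hturn : ∀ z ∈ T, z ∉ T₀ → ¬ ZTurn T z ∧ ¬ STurn T z) : Linked T₀ := by
  refine ⟨fun z hz w hw hzw => ?_, fun z hz w hw hzw => ?_⟩
  · obtain ⟨y, hy, hzy, e | e⟩ := h.1 z (hsub hz) w (hsub hw) hzw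
    · obtain ⟨x, hx, ex, hyx, hmax⟩ := exists_maximal_of_mem hf (P := fun x => z.1 = x.1) hy e
      refine ⟨x, ?_, hzy.trans_le hyx, .inl ex⟩
      by_contra hx₀
      have hxt : x < top := (hle x hx).2.lt_of_ne (by rintro rfl; exact hx₀ htop)
      obtain ⟨b, hb, hxb, e' | e'⟩ := h.1 x hx top (hsub htop) hxt
      · exact hmax b hb (ex.trans e') hxb
      · exact (hturn x hx hx₀).1 ⟨⟨z, hsub hz, hzy.trans_le hyx, ex⟩, b, hb, hxb, e'.symm⟩
    · obtain ⟨x, hx, ex, hyx, hmax⟩ := exists_maximal_of_mem hf (P := fun x => z.2 = x.2) hy e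
      refine ⟨x, ?_, hzy.trans_le hyx, .inr ex⟩
      by_contra hx₀
      have hxt : x < top := (hle x hx).2.lt_of_ne (by rintro rfl; exact hx₀ htop)
      obtain ⟨b, hb, hxb, e' | e'⟩ := h.1 x hx top (hsub htop) hxt
      · exact (hturn x hx hx₀).2 ⟨⟨z, hsub hz, hzy.trans_le hyx, ex⟩, b, hb, hxb, e'.symm⟩
      · exact hmax b hb (ex.trans e') hxb
  · obtain ⟨y, hy, hzy, e | e⟩ := h.2 z (hsub hz) w (hsub hw) hzw
    · obtain ⟨x, hx, ex, hyx, hmax⟩ := exists_minimal_of_mem hf (P := fun x => z.1 = x.1) hy e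
      refine ⟨x, ?_, hyx.trans_lt hzy, .inl ex⟩
      by_contra hx₀
      have hxt : bot < x := (hle x hx).1.lt_of_ne (by rintro rfl; exact hx₀ hbot)
      obtain ⟨b, hb, hxb, e' | e'⟩ := h.2 x hx bot (hsub hbot) hxt
      · exact hmax b hb (ex.trans e') hxb
      · exact (hturn x hx hx₀).2 ⟨⟨b, hb, hxb, e'.symm⟩, z, hsub hz, hyx.trans_lt hzy, ex⟩
    · obtain ⟨x, hx, ex, hyx, hmax⟩ := exists_minimal_of_mem hf (P := fun x => z.2 = x.2) hy e
      refine ⟨x, ?_, hyx.trans_lt hzy, .inr ex⟩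
      by_contra hx₀
      have hxt : bot < x := (hle x hx).1.lt_of_ne (by rintro rfl; exact hx₀ hbot)
      obtain ⟨b, hb, hxb, e' | e'⟩ := h.2 x hx bot (hsub hbot) hxt
      · exact (hturn x hx hx₀).1 ⟨⟨b, hb, hxb, e'.symm⟩, z, hsub hz, hyx.trans_lt hzy, ex⟩
      · exact hmax b hb (ex.trans e') hxb

end Refine

end Accordion

namespace Accordion

/-! ### Chords crossing a solid diagonal -/

theorem crosses_mk {a b c d : ℕ} : Crosses s(a, b) s(c, d) ↔
    (Clockwise a c b ∧ Clockwise b d a) ∨ (Clockwise a d b ∧ Clockwise b c a) := by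
  constructor
  · rintro ⟨a', b', c', d', h₁, h₂, h₃, h₄⟩
    rw [Sym2.eq_iff] at h₁ h₂
    rcases h₁ with ⟨rfl, rfl⟩ | ⟨rfl, rfl⟩ <;> rcases h₂ with ⟨rfl, rfl⟩ | ⟨rfl, rfl⟩ <;> tauto
  · rintro (⟨h₁, h₂⟩ | ⟨h₁, h₂⟩)
    exacts [⟨a, b, c, d, rfl, rfl, h₁, h₂⟩, ⟨a, b, d, c, rfl, Sym2.eq_swap, h₁, h₂⟩]

theorem Crosses.symm {e f : Sym2 ℕ} (h : Crosses e f) : Crosses f e := by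
  obtain ⟨a, b, c, d, rfl, rfl, h₁, h₂⟩ := h
  rw [crosses_mk]
  unfold Clockwise at *
  omega

/-- `s(a, b)` crosses the chord `s(p, q)`, `p < q`, with its endpoint `a` between `p` and `q`. -/
def Across (p q a b : ℕ) : Prop := p < a ∧ a < q ∧ (b < p ∨ q < b)

theorem crosses_iff_across {p q a b : ℕ} (hpq : p < q) :
    Crosses s(a, b) s(p, q) ↔ Across p q a b ∨ Across p q b a := by
  rw [crosses_mk]; unfold Clockwise Across; omega

theorem crosses_iff_across_of_lt {c d x y : ℕ} (hcd : c < d) :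
    Crosses s(c, d) s(x, y) ↔ Across c d x y ∨ Across c d y x :=
  ⟨fun h => (crosses_iff_across hcd).1 h.symm, fun h => ((crosses_iff_across hcd).2 h).symm⟩

theorem Across.eq {p q a b a' b' : ℕ} (h : Across p q a b) (h' : Across p q a' b')
    (e : s(a, b) = s(a', b')) : a = a' ∧ b = b' := by
  rw [Sym2.eq_iff] at e; unfold Across at *; omega

theorem exists_solid_lt {n : ℕ} {δ : Sym2 ℕ} (h : IsDiagonal (solid n) δ) :
    ∃ p q, p ∈ solid n ∧ q ∈ solid n ∧ p < q ∧ δ = s(p, q) := by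
  obtain ⟨a, ha, b, hb, hab, rfl⟩ := h
  rcases hab.lt_or_gt with h | h
  exacts [⟨a, b, ha, hb, h, rfl⟩, ⟨b, a, hb, ha, h, Sym2.eq_swap⟩]

variable {V : Set ℕ} {D : Finset (Sym2 ℕ)} {n p q : ℕ}

theorem mem_of_withBoundary (hD : IsDissection V D) {a b : ℕ}
    (h : s(a, b) ∈ withBoundary V D) : a ∈ V ∧ b ∈ V := by
  obtain ⟨c, hc, d, hd, e⟩ : ∃ c ∈ V, ∃ d ∈ V, s(a, b) = s(c, d) := by
    rcases h with h | ⟨c, hc, d, hd, -, -, e⟩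
    · obtain ⟨c, hc, d, hd, -, e⟩ := (hD.1 _ h).1
      exact ⟨c, hc, d, hd, e⟩
    · exact ⟨c, hc, d, hd, e⟩
  rw [Sym2.eq_iff] at e
  rcases e with ⟨rfl, rfl⟩ | ⟨rfl, rfl⟩
  exacts [⟨hc, hd⟩, ⟨hd, hc⟩]

theorem IsBoundaryEdge.not_crosses {e : Sym2 ℕ} (he : IsBoundaryEdge V e) {a b : ℕ} (ha : a ∈ V)
    (hb : b ∈ V) : ¬ Crosses e s(a, b) := by
  obtain ⟨c, -, d, -, -, h, rfl⟩ := he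
  rw [crosses_mk]
  rintro (h' | h')
  exacts [h a ha h'.1, h b hb h'.1]

theorem not_crosses_withBoundary (hD : IsDissection V D) {e f : Sym2 ℕ}
    (he : e ∈ withBoundary V D) (hf : f ∈ withBoundary V D) : ¬ Crosses e f := by
  obtain ⟨a, b⟩ := e
  obtain ⟨c, d⟩ := f
  rcases id he with he' | he'
  · rcases id hf with hf' | hf'
    · exact hD.2 _ he' _ hf'
    · obtain ⟨ha, hb⟩ := mem_of_withBoundary hD he
      exact fun h => hf'.not_crosses ha hb h.symm
  · obtain ⟨hc, hd⟩ := mem_of_withBoundary hD hf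
    exact he'.not_crosses hc hd

theorem mem_crossedBy_iff (hpq : p < q) {e : Sym2 ℕ} : e ∈ crossedBy n D s(p, q) ↔
    ∃ a b, Across p q a b ∧ s(a, b) ∈ withBoundary (hollow n) D ∧ e = s(a, b) := by
  constructor
  · rintro ⟨he, hc⟩
    obtain ⟨a, b⟩ := e
    rcases (crosses_iff_across hpq).1 hc with h | h
    exacts [⟨a, b, h, he, rfl⟩, ⟨b, a, h, Sym2.eq_swap ▸ he, Sym2.eq_swap⟩]
  · rintro ⟨a, b, h, he, rfl⟩
    exact ⟨he, (crosses_iff_across hpq).2 (.inl h)⟩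

/-- A coordinate on the points outside the interval from `p` to `q`: it increases as one walks
anticlockwise from `p` to `q`. -/
def outer (n p b : ℕ) : ℤ := if b < p then -(b + 2 * n : ℤ) else -b

/-- The point of the plane that represents the chord `s(a, b)`. -/
def chordPoint (n p a b : ℕ) : ℤ × ℤ := (a, outer n p b)

/-- The chords of `D` with boundary that cross `s(p, q)`, as points of the plane. -/
def cut (n : ℕ) (D : Finset (Sym2 ℕ)) (p q : ℕ) : Set (ℤ × ℤ) :=
  {x | ∃ a b, Across p q a b ∧ s(a, b) ∈ withBoundary (hollow n) D ∧ x = chordPoint n p a b}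

theorem Across.outer_eq {a b : ℕ} (h : Across p q a b) (n : ℕ) :
    (b < p ∧ outer n p b = -(b + 2 * n : ℤ)) ∨ (q < b ∧ outer n p b = -b) := by
  unfold Across at h
  unfold outer
  split_ifs <;> omega

theorem outer_inj {b b' : ℕ} (hb : b ∈ hollow n) (hb' : b' ∈ hollow n) :
    outer n p b = outer n p b' ↔ b = b' := by
  obtain ⟨-, h₁, h₂⟩ := hb
  obtain ⟨-, h₃, h₄⟩ := hb'
  unfold outer
  split_ifs <;> omega

theorem chordPoint_inj {a b a' b' : ℕ} (hb : b ∈ hollow n) (hb' : b' ∈ hollow n) :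
    chordPoint n p a b = chordPoint n p a' b' ↔ a = a' ∧ b = b' := by
  rw [chordPoint, chordPoint, Prod.mk.injEq, outer_inj hb hb', Nat.cast_inj]

theorem share_chordPoint {a b a' b' : ℕ} (h : Across p q a b) (h' : Across p q a' b')
    (hb : b ∈ hollow n) (hb' : b' ∈ hollow n) :
    Share (chordPoint n p a b) (chordPoint n p a' b') ↔ ∃ v, v ∈ s(a, b) ∧ v ∈ s(a', b') := by
  unfold Share chordPoint
  rw [outer_inj hb hb', Nat.cast_inj]
  simp only [Sym2.mem_iff]
  constructor
  · rintro (rfl | rfl)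
    exacts [⟨a, by simp⟩, ⟨b, by simp⟩]
  · rintro ⟨v, rfl | rfl, rfl | rfl⟩
    · exact .inl rfl
    · unfold Across at *; omega
    · unfold Across at *; omega
    · exact .inr rfl

theorem chordPoint_mem_cut_iff (hD : IsDissection (hollow n) D) {a b : ℕ} (h : Across p q a b)
    (hb : b ∈ hollow n) :
    chordPoint n p a b ∈ cut n D p q ↔ s(a, b) ∈ withBoundary (hollow n) D := by
  constructor
  · rintro ⟨a', b', h', hm, e⟩
    obtain ⟨rfl, rfl⟩ := (chordPoint_inj hb (mem_of_withBoundary hD hm).2).1 e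
    exact hm
  · exact fun hm => ⟨a, b, h, hm, rfl⟩

/-- Two chords across s(p, q) fail to cross exactly when their inner endpoints, read clockwise, and
their outer endpoints, read anticlockwise, are in the same weak order. -/
theorem isChain_cut (hD : IsDissection (hollow n) D) : IsChain (· ≤ ·) (cut n D p q) := by
  rintro _ ⟨a, b, h, hm, rfl⟩ _ ⟨a', b', h', hm', rfl⟩ -
  have hc := not_crosses_withBoundary hD hm hm'
  obtain ⟨-, -, h₁, h₂⟩ := mem_of_withBoundary hD hm
  obtain ⟨-, -, h₃, h₄⟩ := mem_of_withBoundary hD hm'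
  rw [crosses_mk] at hc
  unfold Across at h h'
  simp only [Prod.le_def, chordPoint, outer]
  unfold Clockwise at hc
  split_ifs <;> omega

/-- The boundary edge of the hollow polygon that joins the two vertices adjacent to `p`. -/
def cutBot (n p : ℕ) : ℤ × ℤ := chordPoint n p (p + 1) (p - 1)

/-- The boundary edge of the hollow polygon that joins the two vertices adjacent to `q`. -/
def cutTop (n p q : ℕ) : ℤ × ℤ := chordPoint n p (q - 1) (if q = 2 * n then 1 else q + 1)

theorem cutBot_mem (hp : p ∈ solid n) (hq : q ∈ solid n) (hpq : p < q) :
    cutBot n p ∈ cut n D p q := by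
  obtain ⟨⟨p, rfl⟩, hp₁, hp₂⟩ := hp
  obtain ⟨⟨q, rfl⟩, hq₁, hq₂⟩ := hq
  refine ⟨_, _, ?_, .inr ⟨p + p - 1, ?_, p + p + 1, ?_, by omega, ?_, Sym2.eq_swap⟩, rfl⟩
  · unfold Across; omega
  · exact ⟨⟨p - 1, by omega⟩, by omega, by omega⟩
  · exact ⟨⟨p, by omega⟩, by omega, by omega⟩
  · rintro c ⟨⟨c, rfl⟩, hc₁, hc₂⟩
    unfold Clockwise
    omega

theorem cutTop_mem (hp : p ∈ solid n) (hq : q ∈ solid n) (hpq : p < q) :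
    cutTop n p q ∈ cut n D p q := by
  obtain ⟨⟨p, rfl⟩, hp₁, hp₂⟩ := hp
  obtain ⟨⟨q, rfl⟩, hq₁, hq₂⟩ := hq
  -- Only the larger endpoint can be the last label 2n, whose clockwise successor is 1; the vertices
  -- next to p need no such wrap.
  refine ⟨_, _, ?_, .inr ⟨q + q - 1, ?_, if q + q = 2 * n then 1 else q + q + 1, ?_, ?_, ?_, rfl⟩,
    rfl⟩
  · unfold Across; split_ifs <;> omega
  · exact ⟨⟨q - 1, by omega⟩, by omega, by omega⟩
  · split_ifs
    · exact ⟨⟨0, by omega⟩, by omega, by omega⟩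
    · exact ⟨⟨q, by omega⟩, by omega, by omega⟩
  · split_ifs <;> omega
  · rintro c ⟨⟨c, rfl⟩, hc₁, hc₂⟩
    unfold Clockwise
    split_ifs <;> omega

theorem cut_bounds (hD : IsDissection (hollow n) D) (hp : p ∈ solid n) (hq : q ∈ solid n)
    {x : ℤ × ℤ} (hx : x ∈ cut n D p q) : cutBot n p ≤ x ∧ x ≤ cutTop n p q := by
  obtain ⟨a, b, h, hm, rfl⟩ := hx
  obtain ⟨-, ⟨b, rfl⟩, h₁, h₂⟩ := mem_of_withBoundary hD hm
  obtain ⟨⟨p, rfl⟩, hp₁, hp₂⟩ := hp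
  obtain ⟨⟨q, rfl⟩, hq₁, hq₂⟩ := hq
  unfold Across at h
  simp only [Prod.le_def, cutBot, cutTop, chordPoint, outer]
  split_ifs <;> omega

theorem finite_cut (hD : IsDissection (hollow n) D) (hp : p ∈ solid n) (hq : q ∈ solid n) :
    (cut n D p q).Finite :=
  (Set.finite_Icc (cutBot n p) (cutTop n p q)).subset fun _ hx => cut_bounds hD hp hq hx

/-! ### Connected cuts are linked chains -/

theorem linked_of_isConnectedChords (hD : IsDissection (hollow n) D) (hpq : p < q)
    (h : IsConnectedChords (crossedBy n D s(p, q))) : Linked (cut n D p q) := by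
  have hT := isChain_cut hD (p := p) (q := q)
  have key : ∀ {a b : ℕ} {e : Sym2 ℕ}, Across p q a b → s(a, b) ∈ withBoundary (hollow n) D →
      e ∈ crossedBy n D s(p, q) → (∃ v, v ∈ s(a, b) ∧ v ∈ e) →
      ∃ x y, Across p q x y ∧ s(x, y) ∈ withBoundary (hollow n) D ∧ e = s(x, y) ∧
        Share (chordPoint n p a b) (chordPoint n p x y) := by
    intro a b e hab hm he hv
    obtain ⟨x, y, hxy, hm', rfl⟩ := (mem_crossedBy_iff hpq).1 he
    exact ⟨x, y, hxy, hm', rfl, (share_chordPoint hab hxy (mem_of_withBoundary hD hm).2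
      (mem_of_withBoundary hD hm').2).2 hv⟩
  constructor
  · rintro z hz _ ⟨a, b, hab, hm, rfl⟩ hzw
    obtain ⟨a₀, b₀, hab₀, hm₀, rfl⟩ := hz
    have hpath := h.2 _ ((mem_crossedBy_iff hpq).2 ⟨a₀, b₀, hab₀, hm₀, rfl⟩) _
      ((mem_crossedBy_iff hpq).2 ⟨a, b, hab, hm, rfl⟩)
    by_contra! hcon
    -- If z has no larger partner, a path from z never rises above z: a step from below z to above z
    -- along one coordinate would make its target share that coordinate with z.
    have : ∀ e, Relation.ReflTransGen (fun x y => x ∈ crossedBy n D s(p, q) ∧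
        y ∈ crossedBy n D s(p, q) ∧ ∃ v, v ∈ x ∧ v ∈ y) s(a₀, b₀) e →
        ∃ x y, Across p q x y ∧ s(x, y) ∈ withBoundary (hollow n) D ∧ e = s(x, y) ∧
          chordPoint n p x y ≤ chordPoint n p a₀ b₀ := by
      intro e he
      induction he with
      | refl => exact ⟨a₀, b₀, hab₀, hm₀, rfl, le_rfl⟩
      | tail _ hstep ih =>
        obtain ⟨x, y, hxy, hm', rfl, hle⟩ := ih
        obtain ⟨x', y', hxy', hm'', rfl, hs⟩ := key hxy hm' hstep.2.1 hstep.2.2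
        refine ⟨x', y', hxy', hm'', rfl, ?_⟩
        have hmem : chordPoint n p x' y' ∈ cut n D p q := ⟨_, _, hxy', hm'', rfl⟩
        rcases chain_trichotomy hT hmem ⟨_, _, hab₀, hm₀, rfl⟩ with h | h | h
        · exact h.le
        · exact h.le
        · refine absurd ?_ (hcon _ hmem h)
          rw [lt_iff_coord] at h
          rw [Prod.le_def] at hle
          unfold Share at *
          omega
    obtain ⟨x, y, hxy, -, e, hle⟩ := this _ hpath
    obtain ⟨rfl, rfl⟩ := hab.eq hxy e
    exact absurd hle (not_le_of_gt hzw)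
  · rintro z hz _ ⟨a, b, hab, hm, rfl⟩ hzw
    obtain ⟨a₀, b₀, hab₀, hm₀, rfl⟩ := hz
    have hpath := h.2 _ ((mem_crossedBy_iff hpq).2 ⟨a₀, b₀, hab₀, hm₀, rfl⟩) _
      ((mem_crossedBy_iff hpq).2 ⟨a, b, hab, hm, rfl⟩)
    by_contra! hcon
    have : ∀ e, Relation.ReflTransGen (fun x y => x ∈ crossedBy n D s(p, q) ∧
        y ∈ crossedBy n D s(p, q) ∧ ∃ v, v ∈ x ∧ v ∈ y) s(a₀, b₀) e →
        ∃ x y, Across p q x y ∧ s(x, y) ∈ withBoundary (hollow n) D ∧ e = s(x, y) ∧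
          chordPoint n p a₀ b₀ ≤ chordPoint n p x y := by
      intro e he
      induction he with
      | refl => exact ⟨a₀, b₀, hab₀, hm₀, rfl, le_rfl⟩
      | tail _ hstep ih =>
        obtain ⟨x, y, hxy, hm', rfl, hle⟩ := ih
        obtain ⟨x', y', hxy', hm'', rfl, hs⟩ := key hxy hm' hstep.2.1 hstep.2.2
        refine ⟨x', y', hxy', hm'', rfl, ?_⟩
        have hmem : chordPoint n p x' y' ∈ cut n D p q := ⟨_, _, hxy', hm'', rfl⟩
        rcases chain_trichotomy hT ⟨_, _, hab₀, hm₀, rfl⟩ hmem with h | h | h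
        · exact h.le
        · exact h.le
        · refine absurd ?_ (hcon _ hmem h)
          rw [lt_iff_coord] at h
          rw [Prod.le_def] at hle
          unfold Share at *
          omega
    obtain ⟨x, y, hxy, -, e, hle⟩ := this _ hpath
    obtain ⟨rfl, rfl⟩ := hab.eq hxy e
    exact absurd hle (not_le_of_gt hzw)

theorem isConnectedChords_of_linked (hD : IsDissection (hollow n) D) (hp : p ∈ solid n)
    (hq : q ∈ solid n) (hpq : p < q) (h : Linked (cut n D p q)) :
    IsConnectedChords (crossedBy n D s(p, q)) := by
  obtain ⟨a₁, b₁, hab₁, hm₁, e₁⟩ := cutTop_mem (D := D) hp hq hpq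
  set r : Sym2 ℕ → Sym2 ℕ → Prop := fun x y => x ∈ crossedBy n D s(p, q) ∧
        y ∈ crossedBy n D s(p, q) ∧ ∃ v, v ∈ x ∧ v ∈ y with hr
  have hsymm : Std.Symm r := ⟨fun x y ⟨hx, hy, v, hvx, hvy⟩ => ⟨hy, hx, v, hvy, hvx⟩⟩
  -- Every chord is joined to the top edge by climbing through larger partners; k bounds the
  -- remaining gap in coordinate sum, which each step decreases.
  have key : ∀ k : ℕ, ∀ a b, Across p q a b → s(a, b) ∈ withBoundary (hollow n) D →
      (cutTop n p q).1 + (cutTop n p q).2 ≤ (chordPoint n p a b).1 + (chordPoint n p a b).2 + k →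
      Relation.ReflTransGen r s(a, b) s(a₁, b₁) := by
    intro k
    induction k with
    | zero =>
      intro a b hab hm hk
      have hle := (cut_bounds hD hp hq ⟨a, b, hab, hm, rfl⟩).2
      rcases hle.eq_or_lt with h | h
      · obtain ⟨rfl, rfl⟩ := (chordPoint_inj (mem_of_withBoundary hD hm).2
          (mem_of_withBoundary hD hm₁).2).1 (h.trans e₁)
        exact .refl
      · rw [lt_iff_coord] at h; omega
    | succ k ih =>
      intro a b hab hm hk
      have hmem : chordPoint n p a b ∈ cut n D p q := ⟨a, b, hab, hm, rfl⟩
      have hle := (cut_bounds hD hp hq hmem).2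
      rcases hle.eq_or_lt with hlt | hlt
      · obtain ⟨rfl, rfl⟩ := (chordPoint_inj (mem_of_withBoundary hD hm).2
          (mem_of_withBoundary hD hm₁).2).1 (hlt.trans e₁)
        exact .refl
      · obtain ⟨_, ⟨x, y, hxy, hm', rfl⟩, hlt', hs⟩ :=
          h.1 _ hmem _ (cutTop_mem hp hq hpq) hlt
        refine .head ⟨(mem_crossedBy_iff hpq).2 ⟨a, b, hab, hm, rfl⟩,
          (mem_crossedBy_iff hpq).2 ⟨x, y, hxy, hm', rfl⟩,
          (share_chordPoint hab hxy (mem_of_withBoundary hD hm).2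
            (mem_of_withBoundary hD hm').2).1 hs⟩ (ih x y hxy hm' ?_)
        rw [lt_iff_coord] at hlt'
        push_cast at hk
        omega
  have key' : ∀ e ∈ crossedBy n D s(p, q), Relation.ReflTransGen r e s(a₁, b₁) := by
    intro e he
    obtain ⟨a, b, hab, hm, rfl⟩ := (mem_crossedBy_iff hpq).1 he
    exact key (((cutTop n p q).1 + (cutTop n p q).2) -
      ((chordPoint n p a b).1 + (chordPoint n p a b).2)).toNat a b hab hm (by omega)
  refine ⟨⟨_, (mem_crossedBy_iff hpq).2 ⟨a₁, b₁, hab₁, hm₁, rfl⟩⟩, fun e he f hf => ?_⟩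
  exact (key' e he).trans (Relation.ReflTransGen.stdSymm.symm _ _ (key' f hf))

theorem isConnectedChords_iff (hD : IsDissection (hollow n) D) (hp : p ∈ solid n)
    (hq : q ∈ solid n) (hpq : p < q) :
    IsConnectedChords (crossedBy n D s(p, q)) ↔ Linked (cut n D p q) :=
  ⟨linked_of_isConnectedChords hD hpq, isConnectedChords_of_linked hD hp hq hpq⟩

end Accordion

namespace Accordion

variable {V : Set ℕ} {D : Finset (Sym2 ℕ)} {n p q : ℕ}

/-! ### Cells and signs -/

theorem exists_isCell_superset (hV : V.Finite) {C : Set ℕ} (hC : C ⊆ V)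
    (h : ∀ a ∈ C, ∀ b ∈ C, ∀ e ∈ D, ¬ Crosses e s(a, b)) : ∃ C', IsCell V D C' ∧ C ⊆ C' := by
  have hf : {C : Set ℕ | C ⊆ V ∧ ∀ a ∈ C, ∀ b ∈ C, ∀ e ∈ D, ¬ Crosses e s(a, b)}.Finite :=
    hV.finite_subsets.subset fun _ h => h.1
  obtain ⟨C', hCC', hC'⟩ := hf.exists_le_maximal ⟨hC, h⟩
  exact ⟨C', hC', hCC'⟩

theorem finite_hollow : (hollow n).Finite :=
  (Set.finite_Icc 1 (2 * n)).subset fun _ h => h.2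

/-! ### Consecutive chords of a cut and the cells between them -/

theorem exists_isCell_of_adjacent (hD : IsDissection (hollow n) D) {a b a' b' : ℕ}
    (h : Across p q a b) (h' : Across p q a' b')
    (hm : s(a, b) ∈ withBoundary (hollow n) D) (hm' : s(a', b') ∈ withBoundary (hollow n) D)
    (hlt : chordPoint n p a b < chordPoint n p a' b')
    (hadj : ∀ x ∈ cut n D p q, chordPoint n p a b < x → chordPoint n p a' b' ≤ x) :
    ∃ C, IsCell (hollow n) D C ∧ InCell s(a, b) C ∧ InCell s(a', b') C := by
  have ha := mem_of_withBoundary hD hm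
  have ha' := mem_of_withBoundary hD hm'
  have hT := isChain_cut hD (p := p) (q := q)
  have base : ∀ c d, s(c, d) ∈ D → ¬ Crosses s(c, d) s(a, a') ∧ ¬ Crosses s(c, d) s(a, b') ∧
      ¬ Crosses s(c, d) s(b, a') ∧ ¬ Crosses s(c, d) s(b, b') := by
    suffices H : ∀ c d, s(c, d) ∈ D → c < d →
        ¬ Crosses s(c, d) s(a, a') ∧ ¬ Crosses s(c, d) s(a, b') ∧
        ¬ Crosses s(c, d) s(b, a') ∧ ¬ Crosses s(c, d) s(b, b') by
      intro c d hcd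
      rcases lt_trichotomy c d with h | rfl | h
      · exact H c d hcd h
      · obtain ⟨x, -, y, -, hxy, e⟩ := (hD.1 _ hcd).1
        rw [Sym2.eq_iff] at e
        omega
      · rw [Sym2.eq_swap] at hcd ⊢
        exact H d c hcd h
    intro c d hcd hlt'
    have n₁ := not_crosses_withBoundary hD (.inl hcd) hm
    have n₂ := not_crosses_withBoundary hD (.inl hcd) hm'
    have hside : ∀ x y, Across p q x y → s(x, y) ∈ D →
        chordPoint n p x y ≤ chordPoint n p a b ∨
          chordPoint n p a' b' ≤ chordPoint n p x y := by
      intro x y hxy hmxy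
      have hy : chordPoint n p x y ∈ cut n D p q := ⟨x, y, hxy, .inl hmxy, rfl⟩
      have hx : chordPoint n p a b ∈ cut n D p q := ⟨a, b, h, hm, rfl⟩
      rcases chain_trichotomy hT hy hx with h | h | h
      exacts [.inl h.le, .inl h.le, .inr (hadj _ hy h)]
    obtain ⟨⟨-, hc₁, hc₂⟩, ⟨-, hd₁, hd₂⟩⟩ := mem_of_withBoundary hD (.inl hcd)
    obtain ⟨⟨-, ha₁, ha₂⟩, ⟨-, hb₁, hb₂⟩⟩ := ha
    obtain ⟨⟨-, ha₁', ha₂'⟩, ⟨-, hb₁', hb₂'⟩⟩ := ha'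
    clear hadj hm hm' hT
    simp only [crosses_iff_across_of_lt hlt'] at n₁ n₂ ⊢
    -- A diagonal of D crossing s(p, q) comes weakly before or after both chords in the chain, so it
    -- cannot separate their endpoints.
    by_cases hc : Across p q c d
    · have hbetween := hside c d hc hcd
      clear n₁ n₂ hside
      rw [lt_iff_coord] at hlt
      simp only [Prod.le_def, chordPoint] at hbetween hlt
      rcases h.outer_eq n with ⟨h₁, e₁⟩ | ⟨h₁, e₁⟩ <;>
        rcases h'.outer_eq n with ⟨h₂, e₂⟩ | ⟨h₂, e₂⟩ <;>
        rcases hc.outer_eq n with ⟨h₃, e₃⟩ | ⟨h₃, e₃⟩ <;>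
        rw [e₁, e₂] at hlt <;> rw [e₁, e₂, e₃] at hbetween <;> unfold Across at * <;>
        refine ⟨?_, ?_, ?_, ?_⟩ <;> omega
    by_cases hc' : Across p q d c
    · rw [Sym2.eq_swap] at hcd
      have hbetween := hside d c hc' hcd
      clear n₁ n₂ hside
      rw [lt_iff_coord] at hlt
      simp only [Prod.le_def, chordPoint] at hbetween hlt
      rcases h.outer_eq n with ⟨h₁, e₁⟩ | ⟨h₁, e₁⟩ <;>
        rcases h'.outer_eq n with ⟨h₂, e₂⟩ | ⟨h₂, e₂⟩ <;>
        rcases hc'.outer_eq n with ⟨h₃, e₃⟩ | ⟨h₃, e₃⟩ <;>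
        rw [e₁, e₂] at hlt <;> rw [e₁, e₂, e₃] at hbetween <;> unfold Across at * <;>
        refine ⟨?_, ?_, ?_, ?_⟩ <;> omega
    -- A diagonal not crossing s(p, q) has p and q on one side, and the two chords, which cross s(p,
    -- q) but not this diagonal, stay weakly on that side.
    · clear hside hlt
      unfold Across at *
      refine ⟨?_, ?_, ?_, ?_⟩ <;> omega
  have self : ∀ c d u, ¬ Crosses s(c, d) s(u, u) := by
    intro c d u; rw [crosses_mk]; unfold Clockwise; omega
  obtain ⟨C, hC, hsub⟩ := exists_isCell_superset (D := D) (finite_hollow (n := n))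
    (C := {a, b, a', b'}) (by rintro x (rfl | rfl | rfl | rfl); exacts [ha.1, ha.2, ha'.1, ha'.2])
    (by
      rintro x hx y hy ⟨c, d⟩ hcd
      obtain ⟨h₁, h₂, h₃, h₄⟩ := base c d hcd
      have n₁ := not_crosses_withBoundary hD (.inl hcd) hm
      have n₂ := not_crosses_withBoundary hD (.inl hcd) hm'
      rcases hx with rfl | rfl | rfl | rfl <;> rcases hy with rfl | rfl | rfl | rfl <;>
        first | exact self _ _ _ | assumption | (rw [Sym2.eq_swap (a := x)]; assumption))
  refine ⟨C, hC, fun v hv => hsub ?_, fun v hv => hsub ?_⟩ <;>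
    rcases Sym2.mem_iff.1 hv with rfl | rfl <;> simp

theorem areNeighbors_of_adjacent (hD : IsDissection (hollow n) D) (hpq : p < q)
    {a b a₁ b₁ a₂ b₂ : ℕ}
    (h : Across p q a b) (h₁ : Across p q a₁ b₁) (h₂ : Across p q a₂ b₂) (hm : s(a, b) ∈ D)
    (hm₁ : s(a₁, b₁) ∈ withBoundary (hollow n) D) (hm₂ : s(a₂, b₂) ∈ withBoundary (hollow n) D)
    (hlt₁ : chordPoint n p a₁ b₁ < chordPoint n p a b)
    (hlt₂ : chordPoint n p a b < chordPoint n p a₂ b₂)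
    (hadj₁ : ∀ x ∈ cut n D p q, x < chordPoint n p a b → x ≤ chordPoint n p a₁ b₁)
    (hadj₂ : ∀ x ∈ cut n D p q, chordPoint n p a b < x → chordPoint n p a₂ b₂ ≤ x) :
    AreNeighbors n D s(a, b) s(p, q) s(a₁, b₁) s(a₂, b₂) := by
  have hm' : s(a, b) ∈ withBoundary (hollow n) D := .inl hm
  obtain ⟨C₁, hC₁, i₁, j₁⟩ := exists_isCell_of_adjacent hD h₁ h hm₁ hm' hlt₁ (by
    intro x hx hlt
    rcases chain_trichotomy (isChain_cut hD) hx ⟨a, b, h, hm', rfl⟩ with h | h | h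
    exacts [absurd (hadj₁ x hx h) (not_le_of_gt hlt), h.ge, h.le])
  obtain ⟨C₂, hC₂, j₂, i₂⟩ := exists_isCell_of_adjacent hD h h₂ hm' hm₂ hlt₂ hadj₂
  refine ⟨C₁, C₂, hC₁, hC₂, ?_, j₁, j₂,
    ⟨(mem_crossedBy_iff hpq).2 ⟨_, _, h₁, hm₁, rfl⟩, ?_, i₁⟩,
    ⟨(mem_crossedBy_iff hpq).2 ⟨_, _, h₂, hm₂, rfl⟩, ?_, i₂⟩⟩
  -- The previous and next chords each have an endpoint off s(a, b), and these lie on opposite sides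
  -- of it, so no single cell contains both chords.
  · rintro rfl
    have n₁ := hC₁.1.2 a₁ (i₁ _ (by simp)) a₂ (i₂ _ (by simp)) _ hm
    have n₂ := hC₁.1.2 a₁ (i₁ _ (by simp)) b₂ (i₂ _ (by simp)) _ hm
    have n₃ := hC₁.1.2 b₁ (i₁ _ (by simp)) a₂ (i₂ _ (by simp)) _ hm
    have n₄ := hC₁.1.2 b₁ (i₁ _ (by simp)) b₂ (i₂ _ (by simp)) _ hm
    obtain ⟨-, ⟨-, hb, hb'⟩⟩ := mem_of_withBoundary hD hm'
    obtain ⟨-, ⟨-, hb₁, hb₁'⟩⟩ := mem_of_withBoundary hD hm₁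
    obtain ⟨-, ⟨-, hb₂, hb₂'⟩⟩ := mem_of_withBoundary hD hm₂
    clear hadj₁ hadj₂
    rw [lt_iff_coord] at hlt₁ hlt₂
    simp only [chordPoint, outer] at hlt₁ hlt₂
    have hab : a < b ∨ b < a := by unfold Across at h; omega
    rcases hab with hab | hab
    · simp only [crosses_iff_across_of_lt hab] at n₁ n₂ n₃ n₄
      unfold Across at *
      split_ifs at * <;> omega
    · simp only [Sym2.eq_swap (a := a), crosses_iff_across_of_lt hab] at n₁ n₂ n₃ n₄
      unfold Across at *
      split_ifs at * <;> omega
  · intro e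
    obtain ⟨rfl, rfl⟩ := h₁.eq h e
    exact lt_irrefl _ hlt₁
  · intro e
    obtain ⟨rfl, rfl⟩ := h₂.eq h e
    exact lt_irrefl _ hlt₂

/-- The neighbours are the predecessor and successor in the chain. The bounds by x and y transfer a
coordinate shared with x or y to them. -/
theorem exists_areNeighbors (hD : IsDissection (hollow n) D) (hp : p ∈ solid n)
    (hq : q ∈ solid n) (hpq : p < q) {a b : ℕ} (h : Across p q a b) (hm : s(a, b) ∈ D)
    {x y : ℤ × ℤ} (hx : x ∈ cut n D p q) (hy : y ∈ cut n D p q)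
    (hxz : x < chordPoint n p a b) (hzy : chordPoint n p a b < y) :
    ∃ a₁ b₁ a₂ b₂, Across p q a₁ b₁ ∧ Across p q a₂ b₂ ∧
      s(a₁, b₁) ∈ withBoundary (hollow n) D ∧ s(a₂, b₂) ∈ withBoundary (hollow n) D ∧
      x ≤ chordPoint n p a₁ b₁ ∧ chordPoint n p a₁ b₁ < chordPoint n p a b ∧
      chordPoint n p a b < chordPoint n p a₂ b₂ ∧ chordPoint n p a₂ b₂ ≤ y ∧
      AreNeighbors n D s(a, b) s(p, q) s(a₁, b₁) s(a₂, b₂) := by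
  obtain ⟨_, ⟨a₁, b₁, h₁, hm₁, rfl⟩, hlt₁, hadj₁⟩ :=
    exists_pred (finite_cut hD hp hq) (isChain_cut hD) hx hxz
  obtain ⟨_, ⟨a₂, b₂, h₂, hm₂, rfl⟩, hlt₂, hadj₂⟩ :=
    exists_succ (finite_cut hD hp hq) (isChain_cut hD) hy hzy
  exact ⟨a₁, b₁, a₂, b₂, h₁, h₂, hm₁, hm₂, hadj₁ _ hx hxz, hlt₁, hlt₂, hadj₂ _ hy hzy,
    areNeighbors_of_adjacent hD hpq h h₁ h₂ hm hm₁ hm₂ hlt₁ hlt₂ hadj₁ hadj₂⟩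

/-! ### Slaloms as turns of the chain -/

theorem exists_isZ_iff (hD : IsDissection (hollow n) D) (hp : p ∈ solid n)
    (hq : q ∈ solid n) (hpq : p < q) {a b : ℕ} (h : Across p q a b) (hm : s(a, b) ∈ D) :
    (∃ μ ν, AreNeighbors n D s(a, b) s(p, q) μ ν ∧ IsZ μ s(a, b) ν) ↔
      ZTurn (cut n D p q) (chordPoint n p a b) := by
  have hab := mem_of_withBoundary hD (.inl hm)
  constructor
  · rintro ⟨μ, ν, ⟨-, -, -, -, -, -, -, ⟨hμ, -⟩, ⟨hν, -⟩⟩, w, x, y, z, e₁, e₂, e₃, c₁, c₂⟩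
    obtain ⟨a₁, b₁, h₁, hm₁, rfl⟩ := (mem_crossedBy_iff hpq).1 hμ
    obtain ⟨a₂, b₂, h₂, hm₂, rfl⟩ := (mem_crossedBy_iff hpq).1 hν
    have hab₁ := mem_of_withBoundary hD hm₁
    have hab₂ := mem_of_withBoundary hD hm₂
    -- A Z read backwards is a Z, and `AreNeighbors` does not fix which neighbour comes first along
    -- s(p, q), so both orders occur.
    have key : (a₁ = a ∧ b₂ = b ∧ outer n p b₁ < outer n p b ∧ a < a₂) ∨
        (a₂ = a ∧ b₁ = b ∧ outer n p b₂ < outer n p b ∧ a < a₁) := by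
      obtain ⟨-, -, hb₁, hb₁'⟩ := hab₁
      obtain ⟨-, -, hb₂, hb₂'⟩ := hab₂
      obtain ⟨-, -, hb, hb'⟩ := hab
      rw [Sym2.eq_iff] at e₁ e₂ e₃
      unfold Across at h h₁ h₂
      unfold Clockwise at c₁ c₂
      unfold outer
      rcases e₂ with ⟨rfl, rfl⟩ | ⟨rfl, rfl⟩
      · left; split_ifs <;> omega
      · right; split_ifs <;> omega
    rcases key with ⟨rfl, rfl, k₁, k₂⟩ | ⟨rfl, rfl, k₁, k₂⟩
    · refine ⟨⟨_, ⟨_, _, h₁, hm₁, rfl⟩, ?_, rfl⟩, _, ⟨_, _, h₂, hm₂, rfl⟩, ?_, rfl⟩ <;>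
        rw [lt_iff_coord] <;> simp only [chordPoint] <;> omega
    · refine ⟨⟨_, ⟨_, _, h₂, hm₂, rfl⟩, ?_, rfl⟩, _, ⟨_, _, h₁, hm₁, rfl⟩, ?_, rfl⟩ <;>
        rw [lt_iff_coord] <;> simp only [chordPoint] <;> omega
  · rintro ⟨⟨x, hx, hxz, ex⟩, y, hy, hzy, ey⟩
    obtain ⟨a₁, b₁, a₂, b₂, h₁, h₂, hm₁, hm₂, l₁, l₂, l₃, l₄, hN⟩ :=
      exists_areNeighbors hD hp hq hpq h hm hx hy hxz hzy
    have hab₁ := mem_of_withBoundary hD hm₁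
    have hab₂ := mem_of_withBoundary hD hm₂
    rw [lt_iff_coord] at l₂ l₃
    rw [Prod.le_def] at l₁ l₄
    simp only [chordPoint] at l₁ l₂ l₃ l₄ ex ey
    obtain rfl : a₁ = a := by omega
    obtain rfl : b₂ = b := (outer_inj (p := p) hab₂.2 hab.2).1 (by omega)
    refine ⟨_, _, hN, b₁, a₁, b₂, a₂, Sym2.eq_swap, rfl, Sym2.eq_swap, ?_⟩
    obtain ⟨-, -, hb₁, hb₁'⟩ := hab₁
    obtain ⟨-, -, hb, hb'⟩ := hab
    unfold Across at h h₁ h₂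
    unfold Clockwise
    unfold outer at *
    clear l₁ l₄ ex ey
    split_ifs at * <;> omega

theorem exists_isS_iff (hD : IsDissection (hollow n) D) (hp : p ∈ solid n)
    (hq : q ∈ solid n) (hpq : p < q) {a b : ℕ} (h : Across p q a b) (hm : s(a, b) ∈ D) :
    (∃ μ ν, AreNeighbors n D s(a, b) s(p, q) μ ν ∧ IsS μ s(a, b) ν) ↔
      STurn (cut n D p q) (chordPoint n p a b) := by
  have hab := mem_of_withBoundary hD (.inl hm)
  constructor
  · rintro ⟨μ, ν, ⟨-, -, -, -, -, -, -, ⟨hμ, -⟩, ⟨hν, -⟩⟩, w, x, y, z, e₁, e₂, e₃, c₁, c₂⟩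
    obtain ⟨a₁, b₁, h₁, hm₁, rfl⟩ := (mem_crossedBy_iff hpq).1 hμ
    obtain ⟨a₂, b₂, h₂, hm₂, rfl⟩ := (mem_crossedBy_iff hpq).1 hν
    have hab₁ := mem_of_withBoundary hD hm₁
    have hab₂ := mem_of_withBoundary hD hm₂
    have key : (a₁ = a ∧ b₂ = b ∧ outer n p b < outer n p b₁ ∧ a₂ < a) ∨
        (a₂ = a ∧ b₁ = b ∧ outer n p b < outer n p b₂ ∧ a₁ < a) := by
      obtain ⟨-, -, hb₁, hb₁'⟩ := hab₁
      obtain ⟨-, -, hb₂, hb₂'⟩ := hab₂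
      obtain ⟨-, -, hb, hb'⟩ := hab
      rw [Sym2.eq_iff] at e₁ e₂ e₃
      unfold Across at h h₁ h₂
      unfold Clockwise at c₁ c₂
      unfold outer
      rcases e₂ with ⟨rfl, rfl⟩ | ⟨rfl, rfl⟩
      · left; split_ifs <;> omega
      · right; split_ifs <;> omega
    rcases key with ⟨rfl, rfl, k₁, k₂⟩ | ⟨rfl, rfl, k₁, k₂⟩
    · refine ⟨⟨_, ⟨_, _, h₂, hm₂, rfl⟩, ?_, rfl⟩, _, ⟨_, _, h₁, hm₁, rfl⟩, ?_, rfl⟩ <;>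
        rw [lt_iff_coord] <;> simp only [chordPoint] <;> omega
    · refine ⟨⟨_, ⟨_, _, h₁, hm₁, rfl⟩, ?_, rfl⟩, _, ⟨_, _, h₂, hm₂, rfl⟩, ?_, rfl⟩ <;>
        rw [lt_iff_coord] <;> simp only [chordPoint] <;> omega
  · rintro ⟨⟨x, hx, hxz, ex⟩, y, hy, hzy, ey⟩
    obtain ⟨a₁, b₁, a₂, b₂, h₁, h₂, hm₁, hm₂, l₁, l₂, l₃, l₄, hN⟩ :=
      exists_areNeighbors hD hp hq hpq h hm hx hy hxz hzy
    have hab₁ := mem_of_withBoundary hD hm₁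
    have hab₂ := mem_of_withBoundary hD hm₂
    rw [lt_iff_coord] at l₂ l₃
    rw [Prod.le_def] at l₁ l₄
    simp only [chordPoint] at l₁ l₂ l₃ l₄ ex ey
    obtain rfl : a₂ = a := by omega
    obtain rfl : b₁ = b := (outer_inj (p := p) hab₁.2 hab.2).1 (by omega)
    refine ⟨_, _, hN, a₁, b₁, a₂, b₂, rfl, Sym2.eq_swap, rfl, ?_⟩
    obtain ⟨-, -, hb₂, hb₂'⟩ := hab₂
    obtain ⟨-, -, hb, hb'⟩ := hab
    unfold Across at h h₁ h₂
    unfold Clockwise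
    unfold outer at *
    clear l₁ l₄ ex ey
    split_ifs at * <;> omega

open Classical in
theorem slalomSign_eq (hD : IsDissection (hollow n) D) (hp : p ∈ solid n)
    (hq : q ∈ solid n) (hpq : p < q) {a b : ℕ} (h : Across p q a b) (hm : s(a, b) ∈ D) :
    slalomSign n D s(a, b) s(p, q) =
      if ZTurn (cut n D p q) (chordPoint n p a b) then 1
      else if STurn (cut n D p q) (chordPoint n p a b) then -1 else 0 := by
  have hc : Crosses s(a, b) s(p, q) := (crosses_iff_across hpq).2 (.inl h)
  simp only [slalomSign, hc, true_and, exists_isZ_iff hD hp hq hpq h hm,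
    exists_isS_iff hD hp hq hpq h hm]

theorem slalomSign_of_not_crosses {d δ : Sym2 ℕ} (h : ¬ Crosses d δ) :
    slalomSign n D d δ = 0 := by
  simp [slalomSign, h]

/-! ### Sign coherence -/

/-- Clockwise, the Z gives a, b, e, c. The last two hypotheses confine a' to the arc from b to e and
e' to the arc from c to a. Then p, q', q, p' lie in the successive arcs ab, be, ec, ca, so the
chords pq and p'q' interleave. -/
theorem crosses_of_z_of_s {a b c e a' e' p q p' q' : ℕ}
    (h₁ : Clockwise a b e) (h₂ : Clockwise a e c) (h₃ : Clockwise b a' c) (h₄ : Clockwise b c e')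
    (h₅ : Clockwise a p b) (h₆ : Clockwise e q c) (h₇ : Clockwise c p' e')
    (h₈ : Clockwise b q' a') (h₉ : ¬ Clockwise a e' b) (h₁₀ : ¬ Clockwise e a' c) :
    Clockwise p' p q' ∧ Clockwise q' q p' := by
  -- Each cyclic relation has three linear forms; discarding inconsistent choices early keeps the
  -- case split small.
  rcases h₁ with h₁ | h₁ | h₁ <;> rcases h₂ with h₂ | h₂ | h₂ <;> try (exfalso; omega)
  all_goals rcases h₃ with h₃ | h₃ | h₃ <;> try (exfalso; omega)
  all_goals rcases h₄ with h₄ | h₄ | h₄ <;> try (exfalso; omega)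
  all_goals rcases h₅ with h₅ | h₅ | h₅ <;> try (exfalso; omega)
  all_goals rcases h₆ with h₆ | h₆ | h₆ <;> try (exfalso; omega)
  all_goals rcases h₇ with h₇ | h₇ | h₇ <;> try (exfalso; omega)
  all_goals rcases h₈ with h₈ | h₈ | h₈ <;> try (exfalso; omega)
  all_goals
    unfold Clockwise at *
    omega

theorem clockwise_comm {a b c : ℕ} : Clockwise a b c ↔ Clockwise b c a := by
  unfold Clockwise; omega

theorem clockwise_rotate {a b c e : ℕ} (h₁ : Clockwise a b e) (h₂ : Clockwise a e c) :
    Clockwise b c a ∧ Clockwise c b e := by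
  rcases h₁ with h₁ | h₁ | h₁ <;> rcases h₂ with h₂ | h₂ | h₂ <;> first | (exfalso; omega) | skip
  all_goals
    unfold Clockwise
    omega

theorem not_clockwise_of_clockwise {a b c e p : ℕ} (h₁ : Clockwise a b e)
    (h₂ : Clockwise a e c) (h₃ : Clockwise a p b) : ¬ Clockwise e p c := by
  rcases h₁ with h₁ | h₁ | h₁ <;> rcases h₂ with h₂ | h₂ | h₂ <;> first | (exfalso; omega) | skip
  all_goals rcases h₃ with h₃ | h₃ | h₃ <;> first | (exfalso; omega) | skip
  all_goals
    unfold Clockwise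
    omega

/-- Crossing both outer edges puts an endpoint of δ in each of the arcs ab and ec; these arcs are
disjoint, so the endpoints differ. -/
theorem exists_endpoints {a b c e : ℕ} {δ : Sym2 ℕ} (h₁ : Clockwise a b e)
    (h₂ : Clockwise a e c) (hab : Crosses s(a, b) δ) (hce : Crosses s(c, e) δ) :
    ∃ p q, δ = s(p, q) ∧ Clockwise a p b ∧ Clockwise e q c := by
  obtain ⟨p, q⟩ := δ
  rw [crosses_mk] at hab hce
  rcases hab with ⟨k₁, -⟩ | ⟨k₁, -⟩
  · refine ⟨p, q, rfl, k₁, (hce.resolve_right fun k => ?_).2⟩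
    exact not_clockwise_of_clockwise h₁ h₂ k₁ k.2
  · refine ⟨q, p, Sym2.eq_swap, k₁, (hce.resolve_left fun k => ?_).2⟩
    exact not_clockwise_of_clockwise h₁ h₂ k₁ k.2

theorem crosses_of_isZ_of_isS (hD : IsDissection (hollow n) D) {d δ δ' μ ν μ' ν' : Sym2 ℕ}
    (hμ : μ ∈ crossedBy n D δ) (hν : ν ∈ crossedBy n D δ) (hZ : IsZ μ d ν)
    (hμ' : μ' ∈ crossedBy n D δ') (hν' : ν' ∈ crossedBy n D δ') (hS : IsS μ' d ν') :
    Crosses δ' δ := by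
  obtain ⟨a, b, c, e, rfl, rfl, rfl, h₁, h₂⟩ := hZ
  -- An S read backwards is an S, so it may be taken to run along d from b to c, as the Z does.
  obtain ⟨a', e', hmab, hmce, h₃, h₄⟩ : ∃ a' e', s(a', b) ∈ crossedBy n D δ' ∧
      s(c, e') ∈ crossedBy n D δ' ∧ Clockwise b a' c ∧ Clockwise b c e' := by
    obtain ⟨w, x, y, z, rfl, hd, rfl, h₃, h₄⟩ := hS
    rcases Sym2.eq_iff.1 hd with ⟨rfl, rfl⟩ | ⟨rfl, rfl⟩
    · exact ⟨w, z, hμ', hν', h₃, h₄⟩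
    · refine ⟨z, w, Sym2.eq_swap ▸ hν', Sym2.eq_swap ▸ hμ', ?_, ?_⟩ <;>
        unfold Clockwise at * <;> omega
  obtain ⟨r₁, r₂⟩ := clockwise_rotate h₁ h₂
  obtain ⟨p, q, rfl, h₅, h₆⟩ := exists_endpoints h₁ h₂ hμ.2 hν.2
  obtain ⟨p', q', rfl, h₇, h₈⟩ := exists_endpoints (clockwise_comm.1 h₄)
    (clockwise_comm.1 (clockwise_comm.1 h₃)) hmce.2 hmab.2
  have n₁ := not_crosses_withBoundary hD hμ.1 hmce.1
  have n₂ := not_crosses_withBoundary hD hν.1 hmab.1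
  rw [crosses_mk] at n₁ n₂
  have h₉ : ¬ Clockwise a e' b := fun k => n₁ (.inr ⟨k, r₁⟩)
  have h₁₀ : ¬ Clockwise e a' c := fun k => n₂ (.inr ⟨r₂, k⟩)
  obtain ⟨k₁, k₂⟩ := crosses_of_z_of_s h₁ h₂ h₃ h₄ h₅ h₆ h₇ h₈ h₉ h₁₀
  exact ⟨p', q', p, q, rfl, rfl, k₁, k₂⟩

/-- Non-crossing solid diagonals have signs of the same kind at every hollow diagonal. -/
theorem slalomSign_coherent (hD : IsDissection (hollow n) D) {d δ δ' : Sym2 ℕ}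
    (h : ¬ Crosses δ' δ) (hpos : 0 < slalomSign n D d δ) : 0 ≤ slalomSign n D d δ' := by
  unfold slalomSign at hpos ⊢
  split_ifs at hpos with h₁ h₂
  · obtain ⟨-, μ, ν, ⟨-, -, -, -, -, -, -, ⟨hμ, -⟩, ⟨hν, -⟩⟩, hZ⟩ := h₁
    split_ifs with h₃ h₄
    · norm_num
    · obtain ⟨-, μ', ν', ⟨-, -, -, -, -, -, -, ⟨hμ', -⟩, ⟨hν', -⟩⟩, hS⟩ := h₄
      exact absurd (crosses_of_isZ_of_isS hD hμ hν hZ hμ' hν' hS) h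
    · exact le_rfl
  · norm_num at hpos
  · exact absurd hpos (lt_irrefl _)

end Accordion

namespace Accordion

/-! ### Accordions of a sub-dissection -/

variable {D D' : Finset (Sym2 ℕ)} {n p q : ℕ}

theorem cut_mono (h : D ⊆ D') : cut n D p q ⊆ cut n D' p q := by
  rintro _ ⟨a, b, hab, hm, rfl⟩
  exact ⟨a, b, hab, hm.imp_left (@h _), rfl⟩

theorem slalomSign_eq_zero_iff (hD : IsDissection (hollow n) D) (hp : p ∈ solid n)
    (hq : q ∈ solid n) (hpq : p < q) {a b : ℕ} (h : Across p q a b) (hm : s(a, b) ∈ D) :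
    slalomSign n D s(a, b) s(p, q) = 0 ↔ ¬ ZTurn (cut n D p q) (chordPoint n p a b) ∧
      ¬ STurn (cut n D p q) (chordPoint n p a b) := by
  rw [slalomSign_eq hD hp hq hpq h hm]
  split_ifs <;> simp_all

theorem exists_across (hpq : p < q) {d : Sym2 ℕ} (h : Crosses d s(p, q)) :
    ∃ a b, Across p q a b ∧ d = s(a, b) := by
  obtain ⟨a, b⟩ := d
  rcases (crosses_iff_across hpq).1 h with h | h
  exacts [⟨a, b, h, rfl⟩, ⟨b, a, h, Sym2.eq_swap⟩]

/-- The chords of D' outside D that cross δ are the points added to the smaller chain, and a zero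
sign there means that the larger chain does not turn. -/
theorem isAccordionDiagonal_iff_of_subset (hD : IsDissection (hollow n) D)
    (hD' : IsDissection (hollow n) D') (hDD' : D ⊆ D') {δ : Sym2 ℕ} :
    IsAccordionDiagonal n D δ ↔
      IsAccordionDiagonal n D' δ ∧ ∀ d ∈ D', d ∉ D → slalomSign n D' d δ = 0 := by
  unfold IsAccordionDiagonal
  rw [and_assoc]
  refine and_congr_right fun hδ => ?_
  obtain ⟨p, q, hp, hq, hpq, rfl⟩ := exists_solid_lt hδ
  rw [isConnectedChords_iff hD hp hq hpq, isConnectedChords_iff hD' hp hq hpq]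
  have hsub := cut_mono (n := n) (p := p) (q := q) hDD'
  have hf := finite_cut hD' hp hq
  have hT := isChain_cut (p := p) (q := q) hD'
  have hbot := cutBot_mem (D := D) hp hq hpq
  have htop := cutTop_mem (D := D) hp hq hpq
  have hle : ∀ x ∈ cut n D' p q, _ := fun x hx => cut_bounds hD' hp hq hx
  constructor
  · refine fun h => ⟨h.mono hf hT hsub hbot htop hle, fun d hd hd' => ?_⟩
    by_cases hc : Crosses d s(p, q)
    · obtain ⟨a, b, hab, rfl⟩ := exists_across hpq hc
      rw [slalomSign_eq_zero_iff hD' hp hq hpq hab hd]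
      refine not_turn_of_notMem hf hT hsub hbot htop hle h ⟨a, b, hab, .inl hd, rfl⟩ ?_
      rw [chordPoint_mem_cut_iff hD hab (mem_of_withBoundary hD' (.inl hd)).2]
      rintro (h | h)
      · exact hd' h
      · exact (hD'.1 _ hd).2 h
    · exact slalomSign_of_not_crosses hc
  · rintro ⟨h, h0⟩
    refine h.of_not_turn hf hsub hbot htop hle ?_
    rintro _ ⟨a, b, hab, hm, rfl⟩ hz
    have hd : s(a, b) ∈ D' ∧ s(a, b) ∉ D := by
      rw [chordPoint_mem_cut_iff hD hab (mem_of_withBoundary hD' hm).2] at hz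
      exact ⟨hm.resolve_right fun h => hz (.inr h), fun h => hz (.inl h)⟩
    exact (slalomSign_eq_zero_iff hD' hp hq hpq hab hd.1).1 (h0 _ hd.1 hd.2)

theorem slalomSign_eq_of_subset (hD : IsDissection (hollow n) D)
    (hD' : IsDissection (hollow n) D') (hDD' : D ⊆ D') {δ : Sym2 ℕ}
    (hδ : IsAccordionDiagonal n D δ) {d : Sym2 ℕ} (hd : d ∈ D) :
    slalomSign n D d δ = slalomSign n D' d δ := by
  obtain ⟨p, q, hp, hq, hpq, rfl⟩ := exists_solid_lt hδ.1
  by_cases hc : Crosses d s(p, q)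
  · obtain ⟨a, b, hab, rfl⟩ := exists_across hpq hc
    obtain ⟨hZ, hS⟩ := turn_iff_of_linked (isChain_cut hD') (cut_mono hDD')
      (cutBot_mem hp hq hpq) (cutTop_mem hp hq hpq) (fun x hx => cut_bounds hD' hp hq hx)
      ((isConnectedChords_iff hD hp hq hpq).1 hδ.2)
      (z := chordPoint n p a b) ⟨a, b, hab, .inl hd, rfl⟩
    rw [slalomSign_eq hD hp hq hpq hab hd, slalomSign_eq hD' hp hq hpq hab (hDD' hd)]
    classical exact if_congr hZ rfl (if_congr hS rfl rfl)
  · rw [slalomSign_of_not_crosses hc, slalomSign_of_not_crosses hc]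

/-! ### Sections of the fan -/

theorem mem_coordSubspace {x : D' → ℝ} :
    x ∈ coordSubspace D D' ↔ ∀ d : D', (d : Sym2 ℕ) ∉ D → x d = 0 := by
  constructor
  · intro hx d hd
    induction hx using Submodule.span_induction with
    | mem x hx =>
      obtain ⟨d', hd', rfl⟩ := hx
      exact Pi.single_eq_of_ne (by rintro rfl; exact hd hd') _
    | zero => rfl
    | add x y _ _ hx hy => simp [hx, hy]
    | smul c x _ hx => simp [hx]
  · intro hx
    rw [← Finset.univ_sum_single x]
    refine Submodule.sum_mem _ fun d _ => ?_
    by_cases hd : (d : Sym2 ℕ) ∈ D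
    · have : (Pi.single d (x d) : D' → ℝ) = x d • Pi.single d 1 := by
        rw [← Pi.single_smul, smul_eq_mul, mul_one]
      rw [this]
      exact Submodule.smul_mem _ _ (Submodule.subset_span ⟨d, hd, rfl⟩)
    · rw [hx d hd, Pi.single_zero]
      exact Submodule.zero_mem _

theorem coordEmbedding_gVector (hD : IsDissection (hollow n) D)
    (hD' : IsDissection (hollow n) D') (hDD' : D ⊆ D') {δ : Sym2 ℕ}
    (hδ : IsAccordionDiagonal n D δ) :
    coordEmbedding hDD' (gVector n D δ) = gVector n D' δ := by
  have hinj : Function.Injective fun d : D => (⟨d.1, hDD' d.2⟩ : D') := fun x y h =>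
    Subtype.ext (congrArg (fun z : D' => z.1) h)
  ext d
  rw [coordEmbedding, Function.ExtendByZero.linearMap_apply]
  by_cases hd : (d : Sym2 ℕ) ∈ D
  · exact (hinj.extend_apply (gVector n D δ) 0 ⟨d.1, hd⟩).trans
      (slalomSign_eq_of_subset hD hD' hDD' hδ hd)
  · rw [Function.extend_apply' _ _ _ (by rintro ⟨x, rfl⟩; exact hd x.2)]
    exact (((isAccordionDiagonal_iff_of_subset hD hD' hDD').1 hδ).2 d d.2 hd).symm

theorem map_coordEmbedding_hull (hD : IsDissection (hollow n) D)
    (hD' : IsDissection (hollow n) D') (hDD' : D ⊆ D') {A : Finset (Sym2 ℕ)}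
    (hA : ∀ δ ∈ A, IsAccordionDiagonal n D δ) :
    PointedCone.map (coordEmbedding hDD')
      (PointedCone.hull ℝ (gVector n D '' (A : Set (Sym2 ℕ)))) =
    PointedCone.hull ℝ (gVector n D' '' (A : Set (Sym2 ℕ))) := by
  rw [PointedCone.map, PointedCone.hull, Submodule.map_span, ← Set.image_comp]
  exact congrArg _ (Set.image_congr fun δ hδ => coordEmbedding_gVector hD hD' hDD' (hA δ hδ))

theorem gVector_mem_coordSubspace_iff (hD : IsDissection (hollow n) D)
    (hD' : IsDissection (hollow n) D') (hDD' : D ⊆ D') {δ : Sym2 ℕ}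
    (hδ : IsAccordionDiagonal n D' δ) :
    gVector n D' δ ∈ coordSubspace D D' ↔ IsAccordionDiagonal n D δ := by
  rw [mem_coordSubspace, isAccordionDiagonal_iff_of_subset hD hD' hDD']
  simp [hδ, gVector]

open Classical in
theorem hull_inf_coordSubspace (hD : IsDissection (hollow n) D)
    (hD' : IsDissection (hollow n) D') (hDD' : D ⊆ D') {A : Finset (Sym2 ℕ)}
    (hA : IsAccordionDissection n D' A) :
    PointedCone.hull ℝ (gVector n D' '' (A : Set (Sym2 ℕ))) ⊓
      PointedCone.ofSubmodule (coordSubspace D D') =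
    PointedCone.hull ℝ
      (gVector n D' '' ((A.filter (IsAccordionDiagonal n D) : Finset _) : Set (Sym2 ℕ))) := by
  apply le_antisymm
  · rintro x ⟨hx, hxV⟩
    obtain ⟨c, rfl⟩ := Submodule.mem_span_image_finset_iff_exists_fun' _ |>.1 hx
    have hxV := mem_coordSubspace.1 (PointedCone.mem_ofSubmodule_iff.1 hxV)
    refine Submodule.sum_mem _ fun δ hδ => ?_
    by_cases hc : c δ = 0
    · rw [hc, zero_smul]
      exact Submodule.zero_mem _
    refine Submodule.smul_mem _ _ (Submodule.subset_span ⟨δ, ?_, rfl⟩)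
    rw [Finset.coe_filter]
    refine ⟨hδ, (isAccordionDiagonal_iff_of_subset hD hD' hDD').2
      ⟨hA.2 δ hδ, fun d hd hd' => ?_⟩⟩
    -- The coordinate at d ∉ D vanishes. If δ had a nonzero sign there, coherence would give all
    -- terms that weak sign, so all would vanish, including the one of δ, whose coefficient is
    -- nonzero.
    have hsum : ∑ i ∈ A, (c i : ℝ) * slalomSign n D' d i = 0 := by
      have h := hxV ⟨d, hd⟩ hd'
      rw [Finset.sum_apply] at h
      exact h
    have hc' : (c δ : ℝ) ≠ 0 := fun h => hc (Subtype.ext h)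
    by_contra hne
    rcases lt_or_gt_of_ne hne with h | h
    · have hle : ∀ i ∈ A, (c i : ℝ) * slalomSign n D' d i ≤ 0 := fun i hi =>
        mul_nonpos_of_nonneg_of_nonpos (c i).2 (not_lt.1 fun hi' =>
          not_le_of_gt h (slalomSign_coherent hD' (hA.1.2 δ hδ i hi) hi'))
      exact mul_ne_zero hc' hne ((Finset.sum_eq_zero_iff_of_nonpos hle).1 hsum δ hδ)
    · have hle : ∀ i ∈ A, 0 ≤ (c i : ℝ) * slalomSign n D' d i := fun i hi =>
        mul_nonneg (c i).2 (slalomSign_coherent hD' (hA.1.2 i hi δ hδ) h)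
      exact mul_ne_zero hc' hne ((Finset.sum_eq_zero_iff_of_nonneg hle).1 hsum δ hδ)
  · refine Submodule.span_le.2 ?_
    rintro _ ⟨δ, hδ, rfl⟩
    rw [Finset.coe_filter] at hδ
    exact ⟨Submodule.subset_span ⟨δ, hδ.1, rfl⟩,
      (gVector_mem_coordSubspace_iff hD hD' hDD' (hA.2 δ hδ.1)).2 hδ.2⟩

theorem embedFan_subset (hD : IsDissection (hollow n) D)
    (hD' : IsDissection (hollow n) D') (hDD' : D ⊆ D') :
    embedFan hDD' (gVectorFan n D) ⊆
      {C ∈ gVectorFan n D' | C ≤ PointedCone.ofSubmodule (coordSubspace D D')} := by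
  rintro _ ⟨_, ⟨A, hA, rfl⟩, rfl⟩
  have hA' : ∀ δ ∈ A, IsAccordionDiagonal n D' δ := fun δ hδ =>
    ((isAccordionDiagonal_iff_of_subset hD hD' hDD').1 (hA.2 δ hδ)).1
  rw [map_coordEmbedding_hull hD hD' hDD' hA.2]
  refine ⟨⟨A, ⟨hA.1, hA'⟩, rfl⟩, Submodule.span_le.2 ?_⟩
  rintro _ ⟨δ, hδ, rfl⟩
  exact (gVector_mem_coordSubspace_iff hD hD' hDD' (hA' δ hδ)).2 (hA.2 δ hδ)

theorem subset_fanSection {E : Type*} [AddCommGroup E] [Module ℝ E] (F : Set (PointedCone ℝ E))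
    (V : Submodule ℝ E) : {C ∈ F | C ≤ PointedCone.ofSubmodule V} ⊆ fanSection F V :=
  fun C hC => ⟨C, hC.1, (inf_eq_left.2 hC.2).symm⟩

theorem fanSection_subset (hD : IsDissection (hollow n) D)
    (hD' : IsDissection (hollow n) D') (hDD' : D ⊆ D') :
    fanSection (gVectorFan n D') (coordSubspace D D') ⊆ embedFan hDD' (gVectorFan n D) := by
  classical
  rintro _ ⟨_, ⟨A, hA, rfl⟩, rfl⟩
  have hA' : ∀ δ ∈ A.filter (IsAccordionDiagonal n D), IsAccordionDiagonal n D δ :=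
    fun δ hδ => (Finset.mem_filter.1 hδ).2
  have hsub := Finset.filter_subset (IsAccordionDiagonal n D) A
  refine ⟨_, ⟨A.filter (IsAccordionDiagonal n D),
    ⟨⟨fun e he => hA.1.1 e (hsub he), fun e he f hf => hA.1.2 e (hsub he) f (hsub hf)⟩, hA'⟩,
    rfl⟩, ?_⟩
  rw [map_coordEmbedding_hull hD hD' hDD' hA', hull_inf_coordSubspace hD hD' hDD' hA]

end Accordion

theorem mainTheorem5 (n : ℕ) (hn : 3 ≤ n) (D D' : Finset (Sym2 ℕ))
    (hD : Accordion.IsDissection (Accordion.hollow n) D)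
    (hD' : Accordion.IsDissection (Accordion.hollow n) D') (hDD' : D ⊆ D') :
    Accordion.embedFan hDD' (Accordion.gVectorFan n D) =
        {C ∈ Accordion.gVectorFan n D' |
          C ≤ PointedCone.ofSubmodule (Accordion.coordSubspace D D')} ∧
      Accordion.embedFan hDD' (Accordion.gVectorFan n D) =
        Accordion.fanSection (Accordion.gVectorFan n D') (Accordion.coordSubspace D D') := by
  have h₁ := Accordion.embedFan_subset hD hD' hDD'
  have h₂ := Accordion.subset_fanSection (Accordion.gVectorFan n D')
    (Accordion.coordSubspace D D')
  have h₃ := Accordion.fanSection_subset hD hD' hDD'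
  -- The three collections of cones are included in one another cyclically.
  exact ⟨h₁.antisymm (h₂.trans h₃), (h₁.trans h₂).antisymm h₃⟩
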